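/- For $k\in\mathbb{N}$ order $\{0,1\}^k$ coordinatewise. In the search problem $\mathrm{TARSKI}(2,k)$ one is given oracle access to an unknown monotone function $f:\{0,1\}^k\to\{0,1\}^k$ (querying a vertex $v$ reveals $f(v)$) and has to output a vertex $x$ with $f(x)=x$. A deterministic algorithm is a decision tree which adaptively queries vertices and finally outputs a vertex; a randomized algorithm is a probability distribution over deterministic algorithms. The randomized query complexity $R(k)$ of $\mathrm{TARSKI}(2,k)$ is the infimum, over all randomized algorithms that on every monotone $f$ output a fixed point of $f$ with probability at least $9/10$, of the maximum over monotone $f$ of the expected number of queries issued on $f$; probability and expectation are over the coin tosses of the algorithm. Then $R(k)=\Omega(k)$: there is a constant $c>0$ such that $R(k)\ge c\,k$ for every $k\in\mathbb{N}$. -/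

import Mathlib

open scoped ENNReal

namespace Tarski

/-- The `k`-dimensional grid `{0, …, n-1}^k`; its order is the coordinatewise one. -/
abbrev Grid (n k : ℕ) : Type := Fin k → Fin n

/-- A deterministic query algorithm for functions from `{0, …, n-1}^k` to itself, as a decision
tree: it either stops and outputs a vertex, or queries a vertex `v` and continues in a way that
depends on the answer `f v` (and hence, along the branch, on all earlier answers). -/
inductive DetAlg (n k : ℕ) : Type
  | output (x : Grid n k) : DetAlg n k
  | query (v : Grid n k) (next : Grid n k → DetAlg n k) : DetAlg n k

/-- The vertex returned when the algorithm is run with oracle `f`. -/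
def DetAlg.result {n k : ℕ} (f : Grid n k → Grid n k) : DetAlg n k → Grid n k
  | .output x => x
  | .query v next => (next (f v)).result f

/-- The number of queries issued when the algorithm is run with oracle `f`. -/
def DetAlg.numQueries {n k : ℕ} (f : Grid n k → Grid n k) : DetAlg n k → ℕ
  | .output _ => 0
  | .query v next => (next (f v)).numQueries f + 1

/-- A randomized query algorithm: a probability distribution over deterministic algorithms
(of unbounded depth). There are countably many deterministic algorithms, so `PMF` covers every
probability distribution on them. -/
abbrev RandAlg (n k : ℕ) : Type := PMF (DetAlg n k)

/-- The probability, over the coin tosses of `A`, that `A` returns a fixed point of `f`. -/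
noncomputable def RandAlg.successProb {n k : ℕ} (A : RandAlg n k)
    (f : Grid n k → Grid n k) : ℝ≥0∞ :=
  A.toOuterMeasure {t | f (t.result f) = t.result f}

/-- The expected number of queries, over the coin tosses of `A`, that `A` issues on `f`. -/
noncomputable def RandAlg.expectedQueries {n k : ℕ} (A : RandAlg n k)
    (f : Grid n k → Grid n k) : ℝ≥0∞ :=
  ∑' t : DetAlg n k, A t * (t.numQueries f : ℝ≥0∞)

/-- `A` solves the Tarski search problem: on every monotone `f` it finds a fixed point with
probability at least `9/10`. -/
def RandAlg.Solves {n k : ℕ} (A : RandAlg n k) : Prop :=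
  ∀ f : Grid n k → Grid n k, Monotone f → 9 / 10 ≤ A.successProb f

/-- The worst-case (over monotone `f`) expected number of queries of `A`. -/
noncomputable def RandAlg.cost {n k : ℕ} (A : RandAlg n k) : ℝ≥0∞ :=
  ⨆ (f : Grid n k → Grid n k) (_ : Monotone f), A.expectedQueries f

/-- The randomized query complexity of `TARSKI(n, k)`: the least worst-case expected number of
queries among the randomized algorithms that solve the problem. -/
noncomputable def randomizedQueryComplexity (n k : ℕ) : ℝ≥0∞ :=
  ⨅ (A : RandAlg n k) (_ : A.Solves), A.cost

end Tarski

namespace Tarski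

/-! Yao-style averaging over a uniformly random hidden point `a`, with oracle `stepTowards a`, whose
only fixed point is `a`. An answer depends on `a` only through two scans for a first mismatch with
the query. Each scanned free bit is a mismatch with probability 1/2, so a scan fixes at most 2 bits
on average and a query at most 4 (`le_sum_of_firstIndex`). An output made while some bit is free is
wrong at least half the time. Hence 4 per query plus 2k per wrong output averages at least k
(`card_mul_le_sum_penalizedCost`); an error probability of at most 1/10 leaves the bound k/5. -/

variable {k : ℕ}

/-- The coordinates at which `v` can be lowered (or raised) are scanned in a fixed order; this is
the first `i` in `L` with `v i = d` and `a i = c`. -/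
def firstIndex (v : Grid 2 k) (d c : Fin 2) (L : List (Fin k)) (a : Grid 2 k) : Option (Fin k) :=
  L.find? (fun i => decide (v i = d ∧ a i = c))

/-- Lower `v` at the coordinate `o₁` and raise it at the coordinate `o₂`. -/
def adjust (v : Grid 2 k) (o₁ o₂ : Option (Fin k)) : Grid 2 k :=
  fun j => if o₁ = some j then 0 else if o₂ = some j then 1 else v j

/-- The monotone function with unique fixed point `a` that lowers the first coordinate lying above
`a` and raises the first coordinate lying below `a`. -/
def stepTowards (a v : Grid 2 k) : Grid 2 k :=
  adjust v (firstIndex v 1 0 (List.finRange k) a) (firstIndex v 0 1 (List.finRange k) a)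

theorem firstIndex_spec {v a : Grid 2 k} {d c : Fin 2} {L : List (Fin k)} {i : Fin k}
    (h : firstIndex v d c L a = some i) : v i = d ∧ a i = c := by
  simpa using List.find?_some h

theorem find?_eq_some_of_imp {α : Type*} {p q : α → Bool} (hpq : ∀ x, p x → q x)
    {L : List α} {x : α} (hq : L.find? q = some x) (hp : p x) : L.find? p = some x := by
  induction L with
  | nil => simp at hq
  | cons y L ih =>
    rw [List.find?_cons] at hq ⊢
    cases hy : q y with
    | true =>
      simp only [hy, Option.some.injEq] at hq
      subst hq
      simp [hp]
    | false =>
      have : p y = false := by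
        by_contra hc
        simp [hpq y (by simpa using hc)] at hy
      simp only [hy] at hq
      simp only [this]
      exact ih hq

/-- For `u ≤ v`, the candidates for raising in `v` are among those in `u`, so if `u` raises `j` and
`v j = 0`, then `v` raises `j` too. Lowering is dual. -/
theorem monotone_stepTowards (a : Grid 2 k) : Monotone (stepTowards a) := by
  intro u v huv j
  have key : ∀ x y : Fin 2, (x = 1 → y = 0 → False) → x ≤ y := by decide
  refine key _ _ fun hu hv => ?_
  have huvj : ∀ i, u i ≤ v i := huv
  have up : ∀ i, u i = 1 → v i = 1 := fun i h => by have := huvj i; omega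
  have down : ∀ i, v i = 0 → u i = 0 := fun i h => by have := huvj i; omega
  simp only [stepTowards, adjust] at hu hv
  split_ifs at hu with hu1 hu2
  · simp at hu
  · have su := firstIndex_spec hu2
    split_ifs at hv with hv1 hv2
    · have sv := firstIndex_spec hv1
      simp [su.2] at sv
    · simp at hv
    · refine hv2 (find?_eq_some_of_imp (fun x hx => ?_) hu2 (by simp [hv, su.2]))
      simp only [decide_eq_true_eq] at hx ⊢
      exact ⟨down x hx.1, hx.2⟩
  · split_ifs at hv with hv1 hv2
    · have sv := firstIndex_spec hv1
      refine hu1 (find?_eq_some_of_imp (fun x hx => ?_) hv1 (by simp [hu, sv.2]))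
      simp only [decide_eq_true_eq] at hx ⊢
      exact ⟨up x hx.1, hx.2⟩
    · simp at hv
    · have := up j hu
      omega

theorem eq_of_stepTowards_eq {a v : Grid 2 k} (h : stepTowards a v = v) : v = a := by
  have h1 : firstIndex v 1 0 (List.finRange k) a = none := by
    rw [Option.eq_none_iff_forall_ne_some]
    intro i hi
    have := congrFun h i
    simp [stepTowards, adjust, hi, (firstIndex_spec hi).1] at this
  have h2 : firstIndex v 0 1 (List.finRange k) a = none := by
    rw [Option.eq_none_iff_forall_ne_some]
    intro i hi
    have := congrFun h i
    simp [stepTowards, adjust, hi, h1, (firstIndex_spec hi).1] at this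
  funext i
  have h1 := List.find?_eq_none.1 h1 i (List.mem_finRange i)
  have h2 := List.find?_eq_none.1 h2 i (List.mem_finRange i)
  simp only [decide_eq_true_eq] at h1 h2
  have := (v i).isLt
  have := (a i).isLt
  omega

/-- Negation of the `i`-th bit. -/
def flipAt (i : Fin k) : Equiv.Perm (Grid 2 k) :=
  Function.Involutive.toPerm (fun a => Function.update a i (1 - a i)) (by
    intro a
    funext j
    by_cases h : j = i
    · subst h
      have : ∀ x : Fin 2, 1 - (1 - x) = x := by decide
      simp [this]
    · simp [h])

theorem flipAt_same (i : Fin k) (a : Grid 2 k) : flipAt i a i = 1 - a i := by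
  simp [flipAt, Function.Involutive.toPerm]

theorem flipAt_of_ne {i j : Fin k} (h : j ≠ i) (a : Grid 2 k) : flipAt i a j = a j := by
  simp [flipAt, Function.Involutive.toPerm, h]

theorem two_mul_sum_eq_sum_flipAt (i : Fin k) (F : Grid 2 k → ℝ) :
    2 * ∑ a, F a = ∑ a, (F a + F (flipAt i a)) := by
  rw [Finset.sum_add_distrib, Equiv.sum_comp (flipAt i) F, two_mul]

theorem two_mul_sum_piecewise {S : Finset (Fin k)} {i : Fin k} (hi : i ∈ S) (b : Grid 2 k)
    (c : Fin 2) (F : Grid 2 k → ℝ) :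
    2 * ∑ a, F (S.piecewise a b) =
      ∑ a, F ((S.erase i).piecewise a (Function.update b i c)) +
        ∑ a, F ((S.erase i).piecewise a (Function.update b i (1 - c))) := by
  rw [two_mul_sum_eq_sum_flipAt i, ← Finset.sum_add_distrib]
  refine Finset.sum_congr rfl fun a _ => ?_
  have h1 : S.piecewise a b = (S.erase i).piecewise a (Function.update b i (a i)) := by
    funext j
    by_cases h : j = i
    · subst h; simp [Finset.piecewise, hi]
    · simp [Finset.piecewise, h]
  have h2 : S.piecewise (flipAt i a) b =
      (S.erase i).piecewise a (Function.update b i (1 - a i)) := by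
    funext j
    by_cases h : j = i
    · subst h; simp [Finset.piecewise, hi, flipAt_same]
    · simp [Finset.piecewise, h, flipAt_of_ne h]
  rw [h1, h2]
  have hc : a i = c ∨ a i = 1 - c := by
    generalize a i = x
    revert x c
    decide
  rcases hc with hc | hc
  · rw [hc]
  · have : ∀ x : Fin 2, 1 - (1 - x) = x := by decide
    rw [hc, this, add_comm]

/-- Scanning the bits of a uniformly random point of a subcube until the first hit reveals at most
two free bits on average. -/
theorem le_sum_of_firstIndex (v : Grid 2 k) (d c : Fin 2) (r : ℝ)
    (H : Option (Fin k) → Grid 2 k → ℝ)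
    (hH : ∀ (w : Option (Fin k)) (S : Finset (Fin k)) (b : Grid 2 k),
      ((S.card : ℝ) - r) * 2 ^ k ≤ ∑ a, H w (S.piecewise a b))
    (L : List (Fin k)) (S : Finset (Fin k)) (b : Grid 2 k) :
    ((S.card : ℝ) - (r + 2)) * 2 ^ k ≤
      ∑ a, H (firstIndex v d c L (S.piecewise a b)) (S.piecewise a b) := by
  have pos : (0 : ℝ) < 2 ^ k := by positivity
  induction L generalizing S b with
  | nil =>
    refine le_trans ?_ (hH none S b)
    gcongr
    linarith
  | cons i L ih =>
    have skip : ∀ x : Grid 2 k, ¬ (v i = d ∧ x i = c) →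
        firstIndex v d c (i :: L) x = firstIndex v d c L x := fun x hx => by
      simp [firstIndex, hx]
    have hit : ∀ x : Grid 2 k, v i = d ∧ x i = c →
        firstIndex v d c (i :: L) x = some i := fun x hx => by
      simp [firstIndex, hx]
    by_cases hv : v i = d
    swap
    · refine (ih S b).trans_eq (Finset.sum_congr rfl fun a _ => ?_)
      rw [skip _ fun h => hv h.1]
    by_cases hi : i ∈ S
    · have hcard : ((S.erase i).card : ℝ) = S.card - 1 := by
        have := Finset.card_erase_add_one hi
        rw [← this]
        push_cast
        ring
      have hsplit := two_mul_sum_piecewise hi b c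
        (fun x => H (firstIndex v d c (i :: L) x) x)
      -- Bit `i` becomes fixed in both halves. A hit loses `1 + r`, a miss `1 + (r + 2)`; the mean
      -- is exactly `r + 2`.
      have e1 := hH (some i) (S.erase i) (Function.update b i c)
      have e2 := ih (S.erase i) (Function.update b i (1 - c))
      have f1 : ∀ a : Grid 2 k, firstIndex v d c (i :: L)
          ((S.erase i).piecewise a (Function.update b i c)) = some i := fun a =>
        hit _ ⟨hv, by simp [Finset.piecewise]⟩
      have hne : ∀ x : Fin 2, 1 - x ≠ x := by decide
      have f2 : ∀ a : Grid 2 k, firstIndex v d c (i :: L)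
          ((S.erase i).piecewise a (Function.update b i (1 - c))) = firstIndex v d c L
          ((S.erase i).piecewise a (Function.update b i (1 - c))) := fun a =>
        skip _ fun h => hne c (by simpa [Finset.piecewise] using h.2)
      simp only [f1, f2] at hsplit
      rw [hcard] at e1 e2
      linarith
    -- A bit already fixed decides hit or miss at no cost.
    · by_cases hb : b i = c
      · have f1 : ∀ a : Grid 2 k, firstIndex v d c (i :: L) (S.piecewise a b) = some i := fun a =>
          hit _ ⟨hv, by simp [Finset.piecewise, hi, hb]⟩
        simp only [f1]
        refine le_trans ?_ (hH (some i) S b)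
        gcongr
        linarith
      · refine (ih S b).trans_eq (Finset.sum_congr rfl fun a _ => ?_)
        rw [skip _ fun h => hb (by simpa [Finset.piecewise, hi] using h.2)]

/-- Four times the number of queries on `stepTowards a`, plus a penalty for a wrong output. -/
def penalizedCost (a : Grid 2 k) (t : DetAlg 2 k) : ℕ :=
  4 * t.numQueries (stepTowards a) + 2 * k * if t.result (stepTowards a) = a then 0 else 1

/-- Stated for every subcube (`S` free, the rest as in `b`), since answers restrict `a` to smaller
subcubes. Summing over the whole cube keeps the normalisation `2 ^ k` independent of `S`. -/
theorem card_mul_le_sum_penalizedCost (t : DetAlg 2 k) (S : Finset (Fin k)) (b : Grid 2 k) :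
    (S.card : ℝ) * 2 ^ k ≤ ∑ a, (penalizedCost (S.piecewise a b) t : ℝ) := by
  induction t generalizing S b with
  | output x =>
    obtain rfl | ⟨i, hi⟩ := S.eq_empty_or_nonempty
    · simp only [Finset.card_empty, Nat.cast_zero, zero_mul]
      positivity
    -- Flipping a free bit pairs the hidden points, and `x` is wrong for one of each pair: the
    -- average is at least `k ≥ S.card`.
    have hpair : ∀ a : Grid 2 k, (2 * k : ℝ) ≤
        (penalizedCost (S.piecewise a b) (.output x) : ℝ) +
          penalizedCost (S.piecewise (flipAt i a) b) (.output x) := by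
      intro a
      have hne : x ≠ S.piecewise a b ∨ x ≠ S.piecewise (flipAt i a) b := by
        by_contra! h
        have := congrFun (h.1.symm.trans h.2) i
        have hne : ∀ x : Fin 2, x ≠ 1 - x := by decide
        exact hne (a i) (by simpa [Finset.piecewise, hi, flipAt_same] using this)
      rcases hne with h | h
      · have : (penalizedCost (S.piecewise a b) (.output x) : ℝ) = 2 * k := by
          simp [penalizedCost, DetAlg.numQueries, DetAlg.result, h]
        rw [this]
        simp
      · have : (penalizedCost (S.piecewise (flipAt i a) b) (.output x) : ℝ) = 2 * k := by
          simp [penalizedCost, DetAlg.numQueries, DetAlg.result, h]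
        rw [this]
        simp
    have hsum := Finset.sum_le_sum fun a (_ : a ∈ Finset.univ) => hpair a
    rw [← two_mul_sum_eq_sum_flipAt i
      (fun a => (penalizedCost (S.piecewise a b) (.output x) : ℝ))] at hsum
    simp only [Finset.sum_const, Finset.card_univ, Fintype.card_pi, Fintype.card_fin,
      Finset.prod_const, nsmul_eq_mul, Nat.cast_pow, Nat.cast_ofNat] at hsum
    have hS : (S.card : ℝ) ≤ k := by
      exact_mod_cast (Finset.card_le_univ S).trans_eq (Fintype.card_fin k)
    have : (S.card : ℝ) * 2 ^ k ≤ k * 2 ^ k := by gcongr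
    linarith
  | query v next ih =>
    have hstep : ∀ a : Grid 2 k, penalizedCost a (.query v next) =
        4 + penalizedCost a (next (stepTowards a v)) := fun a => by
      rw [penalizedCost, penalizedCost, DetAlg.numQueries, DetAlg.result, mul_add, mul_one,
        add_right_comm, add_comm 4]
    -- The scans are nested, each losing 2; the total 4 is the charge for the query.
    have h1 := fun w₁ => le_sum_of_firstIndex v 0 1 0
      (fun w₂ a => (penalizedCost a (next (adjust v w₁ w₂)) : ℝ))
      (fun w₂ S b => by simpa using ih (adjust v w₁ w₂) S b) (List.finRange k)
    have h2 := le_sum_of_firstIndex v 1 0 (0 + 2)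
      (fun w₁ a => (penalizedCost a
        (next (adjust v w₁ (firstIndex v 0 1 (List.finRange k) a))) : ℝ))
      h1 (List.finRange k) S b
    simp only [hstep, Nat.cast_add, Finset.sum_add_distrib, Finset.sum_const, Finset.card_univ,
      Fintype.card_pi, Fintype.card_fin, Finset.prod_const, nsmul_eq_mul, Nat.cast_pow,
      Nat.cast_ofNat]
    simp only [stepTowards]
    linarith

theorem mul_le_sum_penalizedCost (t : DetAlg 2 k) :
    k * 2 ^ k ≤ ∑ a : Grid 2 k, penalizedCost a t := by
  have := card_mul_le_sum_penalizedCost t Finset.univ 0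
  simp only [Finset.card_univ, Fintype.card_fin, Finset.piecewise_univ] at this
  exact_mod_cast this

theorem RandAlg.Solves.tsum_wrong_le {A : RandAlg 2 k} (hA : A.Solves) (a : Grid 2 k) :
    ∑' t, A t * (if t.result (stepTowards a) = a then 0 else 1 : ℝ≥0∞) ≤ 1 / 10 := by
  have hs := hA _ (monotone_stepTowards a)
  have hle : A.successProb (stepTowards a) ≤
      ∑' t, A t * (if t.result (stepTowards a) = a then 1 else 0 : ℝ≥0∞) := by
    rw [RandAlg.successProb, PMF.toOuterMeasure_apply]
    refine ENNReal.tsum_le_tsum fun t => ?_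
    by_cases h : t.result (stepTowards a) = a
    · simp only [h, if_true, mul_one]
      exact Set.indicator_le_self _ _ _
    · have : t ∉ {t : DetAlg 2 k |
          stepTowards a (t.result (stepTowards a)) = t.result (stepTowards a)} :=
        fun ht => h (eq_of_stepTowards_eq ht)
      simp [this]
  have htot : ∑' t, A t * (if t.result (stepTowards a) = a then 1 else 0 : ℝ≥0∞) +
      ∑' t, A t * (if t.result (stepTowards a) = a then 0 else 1 : ℝ≥0∞) = 1 := by
    rw [← ENNReal.tsum_add, ← A.tsum_coe]
    refine tsum_congr fun t => ?_
    split_ifs <;> simp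
  have h9 : (9 / 10 : ℝ≥0∞) + 1 / 10 = 1 := by
    rw [ENNReal.div_add_div_same, show (9 + 1 : ℝ≥0∞) = 10 by norm_num]
    exact ENNReal.div_self (by norm_num) (by norm_num)
  have hfin : (9 / 10 : ℝ≥0∞) ≠ ⊤ := by
    intro h
    simp [h] at h9
  refine (ENNReal.add_le_add_iff_left hfin).1 ?_
  rw [h9]
  refine le_of_le_of_eq ?_ htot
  gcongr
  exact hs.trans hle

theorem RandAlg.Solves.le_cost {A : RandAlg 2 k} (hA : A.Solves) :
    (k : ℝ≥0∞) ≤ 4 * A.cost + 2 * k * (1 / 10) := by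
  have hpoint : ∀ a : Grid 2 k, ∑' t, A t * (penalizedCost a t : ℝ≥0∞) ≤
      4 * A.cost + 2 * k * (1 / 10) := by
    intro a
    have hq : A.expectedQueries (stepTowards a) ≤ A.cost :=
      le_iSup₂_of_le (stepTowards a) (monotone_stepTowards a) le_rfl
    have : ∑' t, A t * (penalizedCost a t : ℝ≥0∞) = 4 * A.expectedQueries (stepTowards a) +
        2 * k * ∑' t, A t * (if t.result (stepTowards a) = a then 0 else 1 : ℝ≥0∞) := by
      rw [RandAlg.expectedQueries, ← ENNReal.tsum_mul_left, ← ENNReal.tsum_mul_left,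
        ← ENNReal.tsum_add]
      refine tsum_congr fun t => ?_
      simp only [penalizedCost]
      push_cast
      ring
    rw [this]
    gcongr
    exact hA.tsum_wrong_le a
  have hsum : (2 : ℝ≥0∞) ^ k * k ≤ 2 ^ k * (4 * A.cost + 2 * k * (1 / 10)) := by
    calc (2 : ℝ≥0∞) ^ k * k = ∑' t, A t * (2 ^ k * k) := by
          rw [ENNReal.tsum_mul_right, A.tsum_coe, one_mul]
      _ ≤ ∑' t, A t * ∑ a : Grid 2 k, (penalizedCost a t : ℝ≥0∞) := by
          refine ENNReal.tsum_le_tsum fun t => ?_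
          gcongr
          rw [mul_comm]
          exact_mod_cast mul_le_sum_penalizedCost t
      _ = ∑ a : Grid 2 k, ∑' t, A t * (penalizedCost a t : ℝ≥0∞) := by
          simp only [Finset.mul_sum]
          exact Summable.tsum_finsetSum fun _ _ => ENNReal.summable
      _ ≤ ∑ _a : Grid 2 k, (4 * A.cost + 2 * k * (1 / 10)) :=
          Finset.sum_le_sum fun a _ => hpoint a
      _ = 2 ^ k * (4 * A.cost + 2 * k * (1 / 10)) := by
          simp [mul_add]
  exact (ENNReal.mul_le_mul_iff_right (by positivity) (by finiteness)).1 hsum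

end Tarski

theorem mainTheorem3 :
    ∃ c : ℝ, 0 < c ∧
      ∀ k : ℕ, ENNReal.ofReal (c * (k : ℝ)) ≤ Tarski.randomizedQueryComplexity 2 k := by
  -- From `k ≤ 4 * cost + k / 5`.
  refine ⟨1 / 5, by norm_num, fun k => le_iInf₂ fun A hA => ?_⟩
  have h := hA.le_cost
  rcases eq_or_ne A.cost ⊤ with htop | htop
  · simp [htop]
  rw [ENNReal.ofReal_le_iff_le_toReal htop]
  have hfin : 4 * A.cost + 2 * k * (1 / 10) ≠ ⊤ := by finiteness
  have h' := ENNReal.toReal_mono hfin h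
  rw [ENNReal.toReal_add (by finiteness) (by finiteness)] at h'
  simp only [ENNReal.toReal_mul, ENNReal.toReal_natCast, ENNReal.toReal_div,
    ENNReal.toReal_ofNat, ENNReal.toReal_one] at h'
  linarith
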